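/- Let $k\ge 2$ be a fixed integer. A $k$-DFAO $M$ is a deterministic finite automaton with input alphabet $\{0,1,\dots,k-1\}$ in which an output letter is attached to each state; it generates the $k$-automatic sequence $\mathbf{x}_M=(a(n))_{n\ge 0}$, where $a(n)$ is the output of the state reached from the start state after reading the canonical base-$k$ representation of $n$ (most significant digit first, no leading zeros). A factor of an infinite word is a finite block of consecutive letters of it. An infinite word is recurrent if each of its factors occurs in it infinitely often, and uniformly recurrent if each of its factors occurs in it infinitely often with bounded gaps between consecutive occurrences. Automata are given to algorithms by an explicit finite description (start state, transition table, output table). Theorem. The following four problems are decidable (that is, each is solved by an algorithm that halts on every input). 1. Given a $k$-DFAO $M$, is $\mathbf{x}_M$ recurrent? 2. Given a $k$-DFAO $M$, is $\mathbf{x}_M$ uniformly recurrent? 3. Given two $k$-DFAOs $M$ and $M'$, do $\mathbf{x}_M$ and $\mathbf{x}_{M'}$ have the same set of factors? 4. Given two $k$-DFAOs $M$ and $M'$, is the set of factors of $\mathbf{x}_M$ contained in the set of factors of $\mathbf{x}_{M'}$? -/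

import Mathlib

/-- A deterministic finite automaton with output: input alphabet `Σ_k = Fin k`, finitely many
states `Fin numStates`, and an output letter in `Δ` attached to each state. -/
structure DFAO (k : ℕ) (Δ : Type*) where
  numStates : ℕ
  start : Fin numStates
  step : Fin numStates → Fin k → Fin numStates
  output : Fin numStates → Δ

namespace DFAO

variable {k : ℕ} {Δ : Type*}

/-- The explicit finite description of an automaton: the index of the start state, and the table
which lists for each state its output letter and the indices of its successors. -/
def description (M : DFAO k Δ) : ℕ × List (Δ × (Fin k → ℕ)) :=
  (M.start, List.ofFn fun q => (M.output q, fun d => (M.step q d : ℕ)))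

/-- A start index and a table describe an automaton if all indices are within range. -/
def Valid (c : ℕ × List (Δ × (Fin k → ℕ))) : Prop :=
  c.1 < c.2.length ∧ ∀ row ∈ c.2, ∀ d, row.2 d < c.2.length

instance (c : ℕ × List (Δ × (Fin k → ℕ))) : Decidable (Valid c) :=
  inferInstanceAs (Decidable (_ ∧ _))

/-- The automaton with a given valid description. -/
def ofDescription (c : ℕ × List (Δ × (Fin k → ℕ))) (h : Valid c) : DFAO k Δ where
  numStates := c.2.length
  start := ⟨c.1, h.1⟩
  step q d := ⟨(c.2.get q).2 d, h.2 _ (List.get_mem _ _) d⟩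
  output q := (c.2.get q).1

theorem description_valid (M : DFAO k Δ) : Valid M.description := by
  refine ⟨by simp [description], ?_⟩
  intro row hrow d
  simp only [description, List.mem_ofFn'] at hrow
  obtain ⟨q, rfl⟩ := hrow
  simp [description]

theorem description_ofDescription (c : ℕ × List (Δ × (Fin k → ℕ))) (h : Valid c) :
    (ofDescription c h).description = c := by
  refine Prod.ext rfl ?_
  exact List.ofFn_get c.2

theorem description_injective : Function.Injective (description (k := k) (Δ := Δ)) := by
  rintro ⟨n, s, f, g⟩ ⟨n', s', f', g'⟩ h
  simp only [description, Prod.mk.injEq] at h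
  obtain ⟨h1, h2⟩ := h
  obtain rfl : n = n' := by simpa using congrArg List.length h2
  have h3 := List.ofFn_injective h2
  obtain rfl : s = s' := Fin.ext h1
  obtain rfl : f = f' := by
    funext q d
    exact Fin.ext (congrFun (congrArg Prod.snd (congrFun h3 q)) d)
  obtain rfl : g = g' := by
    funext q
    exact congrArg Prod.fst (congrFun h3 q)
  rfl

/-- Automata correspond exactly to valid descriptions. -/
def equivDescription : DFAO k Δ ≃ {c : ℕ × List (Δ × (Fin k → ℕ)) // Valid c} where
  toFun M := ⟨M.description, M.description_valid⟩
  invFun c := ofDescription c.1 c.2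
  left_inv _ := description_injective (description_ofDescription _ _)
  right_inv _ := Subtype.ext (description_ofDescription _ _)

theorem primrecPred_valid [Primcodable Δ] :
    PrimrecPred (Valid : ℕ × List (Δ × (Fin k → ℕ)) → Prop) := by
  have hR : PrimrecRel fun (d : Fin k) (x : (Δ × (Fin k → ℕ)) × ℕ) => x.1.2 d < x.2 :=
    Primrec.nat_lt.comp
      (Primrec.fin_app.comp (Primrec.snd.comp (Primrec.fst.comp Primrec.snd)) Primrec.fst)
      (Primrec.snd.comp Primrec.snd)
  have hrow : PrimrecRel fun (row : Δ × (Fin k → ℕ)) (n : ℕ) => ∀ d, row.2 d < n :=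
    ((hR.forall_mem_list.comp (Primrec.const (List.finRange k)) Primrec.id).of_eq
      fun x => by simp)
  exact (Primrec.nat_lt.comp Primrec.fst (Primrec.list_length.comp Primrec.snd)).and
    (hrow.forall_mem_list.comp Primrec.snd (Primrec.list_length.comp Primrec.snd))

/-- Automata are given to an algorithm through their explicit finite descriptions. -/
instance [Primcodable Δ] : Primcodable (DFAO k Δ) :=
  letI : Primcodable {c : ℕ × List (Δ × (Fin k → ℕ)) // Valid c} :=
    Primcodable.subtype primrecPred_valid
  Primcodable.ofEquiv _ equivDescription

/-- The state reached from the start state after reading a word. -/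
def run (M : DFAO k Δ) (w : List (Fin k)) : Fin M.numStates :=
  w.foldl M.step M.start

end DFAO

/-- The canonical base-`k` representation `(n)_k`: most significant digit first, no leading zeros
(so that `0` is represented by the empty word). -/
def canonicalRep (k : ℕ) [NeZero k] (n : ℕ) : List (Fin k) :=
  ((Nat.digits k n).map (Fin.ofNat k)).reverse

/-- The `k`-automatic sequence generated by an automaton: its `n`-th letter is the output of the
last state reached on the base-`k` representation of `n`. -/
def DFAO.sequence {k : ℕ} [NeZero k] {Δ : Type*} (M : DFAO k Δ) (n : ℕ) : Δ :=
  M.output (M.run (canonicalRep k n))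

/-- The factor `a[i..i+n-1]` of length `n` beginning at position `i`. -/
def factorAt {Δ : Type*} (a : ℕ → Δ) (i n : ℕ) : List Δ :=
  (List.range n).map fun t => a (i + t)

/-- The set of (finite) factors of an infinite word. -/
def factorSet {Δ : Type*} (a : ℕ → Δ) : Set (List Δ) :=
  {w | ∃ i n, factorAt a i n = w}

/-- The positions at which the word `w` occurs in `a`. -/
def occurrences {Δ : Type*} (a : ℕ → Δ) (w : List Δ) : Set ℕ :=
  {i | factorAt a i w.length = w}

/-- Every factor (a word occurring at least once) occurs infinitely often. -/
def IsRecurrent {Δ : Type*} (a : ℕ → Δ) : Prop :=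
  ∀ w ∈ factorSet a, (occurrences a w).Infinite

/-- Every factor occurs infinitely often, with bounded gaps between consecutive occurrences. -/
def IsUniformlyRecurrent {Δ : Type*} (a : ℕ → Δ) : Prop :=
  ∀ w ∈ factorSet a, (occurrences a w).Infinite ∧
    ∃ t : ℕ, ∀ i ∈ occurrences a w, ∀ j ∈ occurrences a w, i < j →
      (∀ m ∈ occurrences a w, ¬ (i < m ∧ m < j)) → j - i ≤ t

/-! Recurrence, uniform recurrence and containment of factor sets all have the shape `∀ i n, ∃ T, ∀
s, ∃ j, Match ..`; equality is two containments. `Match` is recognizable by a finite automaton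
reading digits in parallel: comparison, addition and equality of letters at shifted positions are
recognizable, and recognizability survives connectives and, by the subset construction, quantifiers.

The automata need not be built; it suffices to bound their numbers of states. If a predicate has at
most `c` states and its parameters have at most `L` digits, pumping (`DigitInvariant.exists_lt`)
yields a witness with at most `L + c` digits whenever one exists. Hence `match_bounded` replaces
every quantifier by one bounded primitive recursively in the sizes of the two given automata, and
exhaustive search decides the formula. -/

/-! ### Digit automata: pumping and projection. -/

/-- `F` is computed by a finite automaton that reads the base-`k` digits of all its arguments in
parallel, most significant digits first: the value after one more digit depends only on the value
before it. -/
def DigitInvariant (k : ℕ) {r : ℕ} {S : Type} (F : (Fin r → ℕ) → S) : Prop :=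
  ∀ x y d : Fin r → ℕ, (∀ v, d v < k) → F x = F y → F (k • x + d) = F (k • y + d)

/-- `P` is recognized by an automaton with at most `c` states reading base-`k` digits in
parallel. -/
def Recognizable (k c : ℕ) {r : ℕ} (P : (Fin r → ℕ) → Prop) : Prop :=
  ∃ (S : Type) (_ : Finite S) (F : (Fin r → ℕ) → S), DigitInvariant k F ∧ Nat.card S ≤ c ∧
    ∀ x y, F x = F y → (P x ↔ P y)

theorem smul_vecCons_add {r : ℕ} (k y e : ℕ) (x d : Fin r → ℕ) :
    k • (Matrix.vecCons y x) + Matrix.vecCons e d = Matrix.vecCons (k * y + e) (k • x + d) := by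
  simp

theorem vecCons_lt {r : ℕ} {b e : ℕ} {d : Fin r → ℕ} (he : e < b) (hd : ∀ v, d v < b) :
    ∀ v, Matrix.vecCons e d v < b :=
  Fin.cases he hd

theorem div_lt_of_lt_pow_succ {k L y : ℕ} (h : y < k ^ (L + 1)) : y / k < k ^ L :=
  Nat.div_lt_of_lt_mul (by rwa [← pow_succ'])

theorem mul_add_lt_pow_succ {k L y e : ℕ} (hy : y < k ^ L) (he : e < k) :
    k * y + e < k ^ (L + 1) := by
  calc k * y + e < k * y + k := by omega
    _ = k * (y + 1) := by ring
    _ ≤ k * k ^ L := Nat.mul_le_mul_left _ hy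
    _ = k ^ (L + 1) := (pow_succ' _ _).symm

/-- The image of `[0, k ^ m)` determines the image of `[0, k ^ (m + 1))`. So these increasing images
are constant once two consecutive ones agree, which happens within `Nat.card S` steps. -/
theorem exists_lt_pow_card {k : ℕ} (hk : 2 ≤ k) {S : Type} [Finite S] {G : ℕ → S}
    (hG : ∀ y y' e, e < k → G y = G y' → G (k * y + e) = G (k * y' + e)) (y : ℕ) :
    ∃ y' < k ^ Nat.card S, G y' = G y := by
  have hk0 : 0 < k := by omega
  have hstep : ∀ {m m'}, G '' Set.Iio (k ^ m) ⊆ G '' Set.Iio (k ^ m') →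
      G '' Set.Iio (k ^ (m + 1)) ⊆ G '' Set.Iio (k ^ (m' + 1)) := by
    rintro m m' h _ ⟨z, hz, rfl⟩
    obtain ⟨u, hu, huz⟩ := h ⟨z / k, div_lt_of_lt_pow_succ hz, rfl⟩
    refine ⟨k * u + z % k, mul_add_lt_pow_succ hu (Nat.mod_lt _ hk0), ?_⟩
    rw [hG u (z / k) _ (Nat.mod_lt _ hk0) huz, Nat.div_add_mod]
  have hmono : Monotone fun m => G '' Set.Iio (k ^ m) := fun m m' h =>
    Set.image_mono (Set.Iio_subset_Iio (Nat.pow_le_pow_right hk0 h))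
  have hcard : ∀ n, Nat.card S ≤ n →
      (G '' Set.Iio (k ^ n)).ncard = (G '' Set.Iio (k ^ Nat.card S)).ncard := fun n hn =>
    Nat.stabilises_of_monotone (f := fun m => (G '' Set.Iio (k ^ m)).ncard)
      (fun m m' h => Set.ncard_le_ncard (hmono h)) (fun m => Set.ncard_le_card _)
      (fun m h => by
        have h1 := Set.eq_of_subset_of_ncard_le (hmono m.le_succ) h.ge
        exact congrArg Set.ncard (Set.Subset.antisymm (hstep h1.subset) (hstep h1.superset))) hn
  have heq := Set.eq_of_subset_of_ncard_le
    (hmono (le_max_right y (Nat.card S))) (hcard _ (le_max_right y _)).le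
  have hy : G y ∈ G '' Set.Iio (k ^ max y (Nat.card S)) :=
    ⟨y, (Nat.lt_pow_self hk).trans_le (Nat.pow_le_pow_right hk0 (le_max_left _ _)), rfl⟩
  obtain ⟨y', h, h'⟩ := heq.superset hy
  exact ⟨y', h, h'⟩

/-- Keep the last `L` digits of `y`. The digits before them are read against `x = 0`, and that
leading part can be shortened to `Nat.card S` digits. -/
theorem DigitInvariant.exists_lt {k : ℕ} (hk : 2 ≤ k) {r : ℕ} {S : Type} [Finite S]
    {F : (Fin (r + 1) → ℕ) → S} (hF : DigitInvariant k F) (L : ℕ) :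
    ∀ x : Fin r → ℕ, (∀ v, x v < k ^ L) → ∀ y,
      ∃ y' < k ^ (L + Nat.card S), F (Matrix.vecCons y' x) = F (Matrix.vecCons y x) := by
  have hk0 : 0 < k := by omega
  induction L with
  | zero =>
    intro x hx y
    obtain rfl : x = 0 := funext fun v => by simpa using hx v
    rw [zero_add]
    refine exists_lt_pow_card hk (G := fun y => F (Matrix.vecCons y 0)) (fun y y' e he h => ?_) y
    have := hF _ _ (Matrix.vecCons e 0) (vecCons_lt he fun _ => hk0) h
    simpa only [smul_vecCons_add, smul_zero, add_zero] using this
  | succ L ih =>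
    intro x hx y
    obtain ⟨y', hy', h⟩ := ih (fun v => x v / k) (fun v => div_lt_of_lt_pow_succ (hx v)) (y / k)
    have hx' : k • (fun v => x v / k) + (fun v => x v % k) = x :=
      funext fun v => Nat.div_add_mod _ _
    have := hF _ _ (Matrix.vecCons (y % k) fun v => x v % k)
      (vecCons_lt (Nat.mod_lt _ hk0) fun v => Nat.mod_lt _ hk0) h
    rw [smul_vecCons_add, smul_vecCons_add, hx', Nat.div_add_mod] at this
    refine ⟨k * y' + y % k, ?_, this⟩
    rw [Nat.succ_add_eq_add_succ]
    exact mul_add_lt_pow_succ hy' (Nat.mod_lt _ hk0)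

/-- The subset construction. As `y` ranges over all numbers, witnesses longer than `x` are already
included. -/
theorem DigitInvariant.range {k : ℕ} (hk : 2 ≤ k) {r : ℕ} {S : Type}
    {F : (Fin (r + 1) → ℕ) → S} (hF : DigitInvariant k F) :
    DigitInvariant k fun x => Set.range fun y => F (Matrix.vecCons y x) := by
  have key : ∀ x x' d : Fin r → ℕ, (∀ v, d v < k) →
      (Set.range fun y => F (Matrix.vecCons y x)) ⊆ (Set.range fun y => F (Matrix.vecCons y x')) →
      (Set.range fun y => F (Matrix.vecCons y (k • x + d))) ⊆
        Set.range fun y => F (Matrix.vecCons y (k • x' + d)) := by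
    rintro x x' d hd h _ ⟨y, rfl⟩
    obtain ⟨y', hy'⟩ := h ⟨y / k, rfl⟩
    have := hF _ _ (Matrix.vecCons (y % k) d) (vecCons_lt (Nat.mod_lt _ (by omega)) hd) hy'
    rw [smul_vecCons_add, smul_vecCons_add, Nat.div_add_mod] at this
    exact ⟨_, this⟩
  exact fun x x' d hd h => Set.Subset.antisymm (key x x' d hd h.subset) (key x' x d hd h.superset)

/-! ### Closure properties and bounded quantifiers. -/

namespace Recognizable

variable {k c c' r : ℕ}

theorem not {P : (Fin r → ℕ) → Prop} (h : Recognizable k c P) :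
    Recognizable k c fun x => ¬ P x := by
  obtain ⟨S, hS, F, hF, hc, hP⟩ := h
  exact ⟨S, hS, F, hF, hc, fun x y hxy => not_congr (hP x y hxy)⟩

theorem const_imp {P : (Fin r → ℕ) → Prop} (p : Prop) (h : Recognizable k c P) :
    Recognizable k c fun x => p → P x := by
  obtain ⟨S, hS, F, hF, hc, hP⟩ := h
  exact ⟨S, hS, F, hF, hc, fun x y hxy => imp_congr_right fun _ => hP x y hxy⟩

theorem and {P P' : (Fin r → ℕ) → Prop} (h : Recognizable k c P) (h' : Recognizable k c' P') :
    Recognizable k (c * c') fun x => P x ∧ P' x := by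
  obtain ⟨S, hS, F, hF, hc, hP⟩ := h
  obtain ⟨S', hS', F', hF', hc', hP'⟩ := h'
  refine ⟨S × S', inferInstance, fun x => (F x, F' x), fun x y d hd hxy => ?_, ?_, fun x y hxy => ?_⟩
  · rw [Prod.mk.injEq] at hxy
    exact Prod.ext (hF x y d hd hxy.1) (hF' x y d hd hxy.2)
  · rw [Nat.card_prod]
    exact Nat.mul_le_mul hc hc'
  · rw [Prod.mk.injEq] at hxy
    exact and_congr (hP x y hxy.1) (hP' x y hxy.2)

theorem imp {P P' : (Fin r → ℕ) → Prop} (h : Recognizable k c P) (h' : Recognizable k c' P') :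
    Recognizable k (c * c') fun x => P x → P' x := by
  simpa only [not_and, not_not] using (h.and h'.not).not

theorem exists_cons (hk : 2 ≤ k) {P : (Fin (r + 1) → ℕ) → Prop} (h : Recognizable k c P) :
    Recognizable k (2 ^ c) fun x => ∃ y, P (Matrix.vecCons y x) := by
  obtain ⟨S, hS, F, hF, hc, hP⟩ := h
  refine ⟨Set S, inferInstance, _, hF.range hk, ?_, fun x x' hxx' => ?_⟩
  · have := Fintype.ofFinite S
    rw [Nat.card_eq_fintype_card, Fintype.card_set, ← Nat.card_eq_fintype_card]
    exact Nat.pow_le_pow_right two_pos hc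
  · have key : ∀ x x' : Fin r → ℕ, (Set.range fun y => F (Matrix.vecCons y x)) ⊆
        (Set.range fun y => F (Matrix.vecCons y x')) →
        (∃ y, P (Matrix.vecCons y x)) → ∃ y, P (Matrix.vecCons y x') := by
      rintro x x' hs ⟨y, hy⟩
      obtain ⟨y', hy'⟩ := hs ⟨y, rfl⟩
      exact ⟨y', (hP _ _ hy').2 hy⟩
    exact ⟨key x x' hxx'.subset, key x' x hxx'.superset⟩

theorem forall_cons (hk : 2 ≤ k) {P : (Fin (r + 1) → ℕ) → Prop} (h : Recognizable k c P) :
    Recognizable k (2 ^ c) fun x => ∀ y, P (Matrix.vecCons y x) := by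
  simpa only [not_exists, not_not] using (h.not.exists_cons hk).not

theorem exists_iff_exists_lt (hk : 2 ≤ k) {P : (Fin (r + 1) → ℕ) → Prop}
    (h : Recognizable k c P) {L b : ℕ} (hb : L + c ≤ b) {x : Fin r → ℕ} (hx : ∀ v, x v < k ^ L) :
    (∃ y, P (Matrix.vecCons y x)) ↔ ∃ y < k ^ b, P (Matrix.vecCons y x) := by
  obtain ⟨S, hS, F, hF, hc, hP⟩ := h
  refine ⟨fun ⟨y, hy⟩ => ?_, fun ⟨y, _, hy⟩ => ⟨y, hy⟩⟩
  obtain ⟨y', hy', hyy'⟩ := hF.exists_lt hk L x hx y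
  exact ⟨y', hy'.trans_le (Nat.pow_le_pow_right (by omega) (by omega)), (hP _ _ hyy').2 hy⟩

theorem forall_iff_forall_lt (hk : 2 ≤ k) {P : (Fin (r + 1) → ℕ) → Prop}
    (h : Recognizable k c P) {L b : ℕ} (hb : L + c ≤ b) {x : Fin r → ℕ} (hx : ∀ v, x v < k ^ L) :
    (∀ y, P (Matrix.vecCons y x)) ↔ ∀ y < k ^ b, P (Matrix.vecCons y x) := by
  have := not_congr (h.not.exists_iff_exists_lt hk hb hx)
  push Not at this
  exact this

end Recognizable

/-! ### Recognizability of order and addition. -/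

/-- Track `δ = c - (a + b)`, which becomes `k * δ + f - d - e`. As `d + e ≤ 2 * k - 2` and `f ≤ k -
1`, the classes `δ ≥ 2` and `δ < 0` are absorbing; only `δ = 0` and `δ = 1` remain to be told apart.
-/
theorem mul_add_trichotomy {k d e f a b c a' b' c' : ℕ} (hd : d < k) (he : e < k) (hf : f < k)
    (h1 : a + b + 1 < c ↔ a' + b' + 1 < c') (h2 : a + b + 1 = c ↔ a' + b' + 1 = c')
    (h3 : a + b = c ↔ a' + b' = c') :
    ((k * a + d) + (k * b + e) + 1 < k * c + f ↔ (k * a' + d) + (k * b' + e) + 1 < k * c' + f) ∧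
    ((k * a + d) + (k * b + e) + 1 = k * c + f ↔ (k * a' + d) + (k * b' + e) + 1 = k * c' + f) ∧
    ((k * a + d) + (k * b + e) = k * c + f ↔ (k * a' + d) + (k * b' + e) = k * c' + f) := by
  have small : ∀ {a b c : ℕ}, a + b + 1 < c → (k * a + d) + (k * b + e) + 1 < k * c + f := by
    intro a b c h
    have := Nat.mul_le_mul_left k h
    simp only [Nat.succ_eq_add_one, mul_add] at this
    omega
  have big : ∀ {a b c : ℕ}, c < a + b → k * c + f < (k * a + d) + (k * b + e) := by
    intro a b c h
    have := Nat.mul_le_mul_left k h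
    simp only [Nat.succ_eq_add_one, mul_add] at this
    omega
  rcases lt_trichotomy (a + b) c with h | h | h
  · rcases (show a + b + 1 ≤ c from h).lt_or_eq with h' | h'
    · have i1 := small h'
      have i2 := small (h1.1 h')
      omega
    · have h'' := h2.1 h'
      subst h'
      subst h''
      simp only [mul_add]
      omega
  · have h'' := h3.1 h
    subst h
    subst h''
    simp only [mul_add]
    omega
  · have i1 := big h
    have i2 := big (show c' < a' + b' by omega)
    omega

theorem recognizable_lt_add {k r : ℕ} (u v w : Fin r) :
    Recognizable k 8 fun x => x w < x u + x v := by
  refine ⟨Prop × Prop × Prop, inferInstance,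
    fun x => (x u + x v + 1 < x w, x u + x v + 1 = x w, x u + x v = x w), ?_, ?_, ?_⟩
  · intro x y d hd h
    simp only [Prod.mk.injEq, eq_iff_iff] at h ⊢
    exact mul_add_trichotomy (hd u) (hd v) (hd w) h.1 h.2.1 h.2.2
  · simp
  · intro x y h
    simp only [Prod.mk.injEq, eq_iff_iff] at h
    omega

theorem recognizable_lt {k r : ℕ} (hk : 2 ≤ k) (u w : Fin r) :
    Recognizable k 8 fun x => x u < x w := by
  refine ⟨Prop × Prop × Prop, inferInstance,
    fun x => (x u + 0 + 1 < x w, x u + 0 + 1 = x w, x u + 0 = x w), ?_, ?_, ?_⟩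
  · intro x y d hd h
    simp only [Prod.mk.injEq, eq_iff_iff] at h ⊢
    exact mul_add_trichotomy (e := 0) (hd u) (by omega) (hd w) h.1 h.2.1 h.2.2
  · simp
  · intro x y h
    simp only [Prod.mk.injEq, eq_iff_iff] at h
    omega

/-! ### Recognizability of equal letters at shifted positions. -/

namespace DFAO

variable {k : ℕ} [NeZero k] {Δ : Type*}

/-- The state reached on the canonical representation of `n`. -/
def stateAt (M : DFAO k Δ) (n : ℕ) : Fin M.numStates :=
  M.run (canonicalRep k n)

theorem stateAt_zero (M : DFAO k Δ) : M.stateAt 0 = M.start := by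
  simp [stateAt, run, canonicalRep]

theorem stateAt_of_pos (M : DFAO k Δ) (hk : 2 ≤ k) {n : ℕ} (hn : 0 < n) :
    M.stateAt n = M.step (M.stateAt (n / k)) (Fin.ofNat k (n % k)) := by
  simp [stateAt, run, canonicalRep, Nat.digits_of_two_le_of_pos hk hn]

/-- `h0` is needed because `0` has the empty representation: appending a digit `0` to it reads
nothing. -/
theorem stateAt_mul_add (M : DFAO k Δ) (hk : 2 ≤ k) {n n' d : ℕ} (hd : d < k)
    (h : M.stateAt n = M.stateAt n') (h0 : n = 0 ↔ n' = 0) :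
    M.stateAt (k * n + d) = M.stateAt (k * n' + d) := by
  by_cases hn : k * n + d = 0
  · have : n = 0 ∧ d = 0 := by
      have : k ≠ 0 := by omega
      simpa [this] using hn
    rw [this.1, h0.1 this.1]
  · have hn' : k * n' + d ≠ 0 := by
      intro h'
      have : k ≠ 0 := by omega
      simp_all
    have e : ∀ m, (k * m + d) / k = m ∧ (k * m + d) % k = d := fun m => by
      rw [Nat.mul_add_div (by omega), Nat.mul_add_mod, Nat.div_eq_of_lt hd, Nat.mod_eq_of_lt hd]
      simp
    rw [stateAt_of_pos M hk (by omega), stateAt_of_pos M hk (n := k * n' + d) (by omega),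
      (e n).1, (e n').1, (e n).2, (e n').2, h]

/-- The states reached on two consecutive numbers, the second of which allows for a carry. -/
def window (M : DFAO k Δ) (n : ℕ) : Fin M.numStates × Fin M.numStates × Prop :=
  (M.stateAt n, M.stateAt (n + 1), n = 0)

/-- A sum of two digits is at most `2 * k - 2`, so both `k * n + v` and its successor have quotient
`n` or `n + 1` by `k`: a carry of one suffices. -/
theorem window_mul_add (M : DFAO k Δ) (hk : 2 ≤ k) {n n' v : ℕ} (hv : v + 1 < 2 * k)
    (h : M.window n = M.window n') : M.window (k * n + v) = M.window (k * n' + v) := by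
  simp only [window, Prod.mk.injEq, eq_iff_iff] at h ⊢
  obtain ⟨h1, h2, h3⟩ := h
  have key : ∀ w < 2 * k, M.stateAt (k * n + w) = M.stateAt (k * n' + w) := by
    intro w hw
    by_cases hwk : w < k
    · exact M.stateAt_mul_add hk hwk h1 h3
    · have e : ∀ m, k * m + w = k * (m + 1) + (w - k) := fun m => by
        rw [mul_add]
        omega
      rw [e, e]
      exact M.stateAt_mul_add hk (by omega) h2 (by simp)
  refine ⟨key v (by omega), key (v + 1) hv, ?_⟩
  have : k ≠ 0 := by omega
  simp [this, h3]

theorem recognizable_sequence_add_eq {Δ : Type*} (M M' : DFAO k Δ) (hk : 2 ≤ k) {r : ℕ}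
    (u v w : Fin r) :
    Recognizable k ((2 * M.numStates ^ 2) * (2 * M'.numStates ^ 2))
      fun x => M.sequence (x u + x w) = M'.sequence (x v + x w) := by
  refine ⟨_, inferInstance, fun x => (M.window (x u + x w), M'.window (x v + x w)), ?_, ?_, ?_⟩
  · intro x y d hd h
    have e : ∀ (x : Fin r → ℕ) i j, (k • x + d) i + (k • x + d) j
        = k * (x i + x j) + (d i + d j) := fun x i j => by
      simp only [Pi.add_apply, Pi.smul_apply, smul_eq_mul]
      ring
    have := hd u
    have := hd v
    have := hd w
    simp only [Prod.mk.injEq] at h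
    simp only [e, Prod.mk.injEq]
    exact ⟨M.window_mul_add hk (by omega) h.1, M'.window_mul_add hk (by omega) h.2⟩
  · apply le_of_eq
    simp
    ring
  · intro x y h
    simp only [window, Prod.mk.injEq] at h
    have e : ∀ (M : DFAO k Δ) n, M.sequence n = M.output (M.stateAt n) := fun _ _ => rfl
    simp only [e, h.1.1, h.2.1]

/-! ### Bounding the quantifiers. -/

/-- The factors of length `n` at position `i` of the one sequence and `j` of the other agree, and
`j` lies in `[s, ∞)` if `p` holds, in `(-∞, s + T)` if `q` holds. -/
def Match (p q : Prop) (M M' : DFAO k Δ) (i n T s j : ℕ) : Prop :=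
  (p → s ≤ j) ∧ (q → j < s + T) ∧ ∀ t < n, M.sequence (i + t) = M'.sequence (j + t)

/-- A bound for the number of states needed to recognize the closure of `Match` under the
quantifiers `∀ n ∃ T ∀ s ∃ j`. -/
def stateBound (a b : ℕ) : ℕ :=
  2 ^ 2 ^ 2 ^ 2 ^ (8 * (8 * 2 ^ (8 * ((2 * a ^ 2) * (2 * b ^ 2)))))

theorem match_bounded (hk : 2 ≤ k) (p q : Prop) (M M' : DFAO k Δ) {c : ℕ}
    (hc : stateBound M.numStates M'.numStates ≤ c) :
    (∀ i n, ∃ T, ∀ s, ∃ j, Match p q M M' i n T s j) ↔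
      ∀ i < k ^ c, ∀ n < k ^ (2 * c), ∃ T < k ^ (3 * c), ∀ s < k ^ (4 * c), ∃ j < k ^ (5 * c),
        Match p q M M' i n T s j := by
  -- Innermost variable first: the coordinates are `t, j, s, T, n, i`, and each quantifier removes
  -- coordinate `0`.
  have r0 : Recognizable k _ fun x : Fin 6 → ℕ =>
      x 0 < x 4 → M.sequence (x 5 + x 0) = M'.sequence (x 1 + x 0) :=
    (recognizable_lt hk 0 4).imp (M.recognizable_sequence_add_eq M' hk 5 1 0)
  have r1 := r0.forall_cons hk
  have r2 := ((recognizable_lt hk 0 1).not.const_imp p).and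
    (((recognizable_lt_add 1 2 0).const_imp q).and r1)
  simp only [not_lt] at r2
  replace r2 : Recognizable k _ fun x : Fin 5 → ℕ =>
    Match p q M M' (x 4) (x 3) (x 2) (x 1) (x 0) := r2
  have r3 := r2.exists_cons hk
  have r4 := r3.forall_cons hk
  have r5 := r4.exists_cons hk
  have r6 := r5.forall_cons hk
  have le_two_pow : ∀ m : ℕ, m ≤ 2 ^ m := fun m => Nat.lt_two_pow_self.le
  have c6 := hc
  rw [stateBound] at c6
  have c5 := (le_two_pow _).trans c6
  have c4 := (le_two_pow _).trans c5
  have c3 := (le_two_pow _).trans c4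
  have c2 := (le_two_pow _).trans c3
  -- The outermost quantifier has no parameters, hence `L = 0`; each later one allows `c` more
  -- digits.
  refine (r6.forall_iff_forall_lt hk (L := 0) (b := c) (by omega) (x := ![]) nofun).trans ?_
  refine forall₂_congr fun i hi => ?_
  have up : ∀ {y m}, y < k ^ (m * c) → y < k ^ ((m + 1) * c) := fun h =>
    h.trans_le (Nat.pow_le_pow_right (by omega) (Nat.mul_le_mul_right _ (Nat.le_succ _)))
  have h1 : ∀ v, ![i] v < k ^ (1 * c) := by
    rw [one_mul]
    exact vecCons_lt hi nofun
  refine (r5.forall_iff_forall_lt hk (b := 2 * c) (by omega) h1).trans ?_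
  refine forall₂_congr fun n hn => ?_
  have h2 : ∀ v, ![n, i] v < k ^ (2 * c) := vecCons_lt hn fun v => up (h1 v)
  refine (r4.exists_iff_exists_lt hk (b := 3 * c) (by omega) h2).trans ?_
  refine exists_congr fun T => and_congr_right fun hT => ?_
  have h3 : ∀ v, ![T, n, i] v < k ^ (3 * c) := vecCons_lt hT fun v => up (h2 v)
  refine (r3.forall_iff_forall_lt hk (b := 4 * c) (by omega) h3).trans ?_
  refine forall₂_congr fun s hs => ?_
  have h4 : ∀ v, ![s, T, n, i] v < k ^ (4 * c) := vecCons_lt hs fun v => up (h3 v)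
  exact r2.exists_iff_exists_lt hk (b := 5 * c) (by omega) h4

end DFAO

/-! ### The decision problems as quantified formulas. -/

theorem factorAt_eq_iff {Δ : Type*} {a b : ℕ → Δ} {i j n : ℕ} :
    factorAt a j n = factorAt b i n ↔ ∀ t < n, b (i + t) = a (j + t) := by
  simp [factorAt, eq_comm]

theorem length_factorAt {Δ : Type*} (a : ℕ → Δ) (i n : ℕ) : (factorAt a i n).length = n := by
  simp [factorAt]

theorem forall_mem_factorSet {Δ : Type*} {a : ℕ → Δ} {p : List Δ → Prop} :
    (∀ w ∈ factorSet a, p w) ↔ ∀ i n, p (factorAt a i n) := by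
  simp only [factorSet, Set.mem_ofPred_eq]
  exact ⟨fun h i n => h _ ⟨i, n, rfl⟩, fun h w ⟨i, n, e⟩ => e ▸ h i n⟩

theorem mem_occurrences_factorAt {Δ : Type*} {a : ℕ → Δ} {i j n : ℕ} :
    j ∈ occurrences a (factorAt a i n) ↔ ∀ t < n, a (i + t) = a (j + t) := by
  rw [occurrences, Set.mem_ofPred_eq, length_factorAt, factorAt_eq_iff]

theorem infinite_iff_forall_exists_ge {s : Set ℕ} : s.Infinite ↔ ∀ m, ∃ j ∈ s, m ≤ j := by
  rw [Set.infinite_iff_exists_gt]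
  exact ⟨fun h m => (h m).imp fun j hj => ⟨hj.1, hj.2.le⟩,
    fun h m => (h (m + 1)).imp fun j hj => ⟨hj.1, hj.2⟩⟩

/-- An infinite set of positions with bounded gaps is one that meets every window of some fixed
length. -/
theorem infinite_and_bounded_gaps_iff {S : Set ℕ} :
    (S.Infinite ∧ ∃ t : ℕ, ∀ i ∈ S, ∀ j ∈ S, i < j → (∀ m ∈ S, ¬ (i < m ∧ m < j)) → j - i ≤ t) ↔
      ∃ T, ∀ s, ∃ j ∈ S, s ≤ j ∧ j < s + T := by
  classical
  constructor
  · rintro ⟨hS, t, ht⟩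
    rw [infinite_iff_forall_exists_ge] at hS
    obtain ⟨i₀, hi₀, -⟩ := hS 0
    -- The summand `i₀` serves windows starting at or before the occurrence `i₀`. For later ones,
    -- the last occurrence before `s` and the first from `s` on are consecutive, hence at most `t`
    -- apart.
    refine ⟨i₀ + t + 1, fun s => ?_⟩
    by_cases hs : s ≤ i₀
    · exact ⟨i₀, hi₀, hs, by omega⟩
    · have hex := hS s
      obtain ⟨hj, hsj⟩ := Nat.find_spec hex
      have hmin : ∀ m ∈ S, m < Nat.find hex → m < s := fun m hm hlt => by
        by_contra hms
        exact Nat.find_min hex hlt ⟨hm, not_lt.1 hms⟩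
      set j := Nat.find hex
      have hi : Nat.findGreatest (· ∈ S) (s - 1) ∈ S :=
        Nat.findGreatest_spec (P := (· ∈ S)) (show i₀ ≤ s - 1 by omega) hi₀
      have hle : Nat.findGreatest (· ∈ S) (s - 1) ≤ s - 1 := Nat.findGreatest_le _
      have := ht _ hi j hj (by omega) fun m hm hmj => by
        have := hmin m hm hmj.2
        have := Nat.le_findGreatest (P := (· ∈ S)) (show m ≤ s - 1 by omega) hm
        omega
      exact ⟨j, hj, hsj, by omega⟩
  · rintro ⟨T, hT⟩
    refine ⟨infinite_iff_forall_exists_ge.2 fun m => (hT m).imp fun j hj => ⟨hj.1, hj.2.1⟩, T, ?_⟩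
    intro i _ j _ hij hgap
    obtain ⟨m, hm, h1, h2⟩ := hT (i + 1)
    have := hgap m hm
    omega

namespace DFAO

variable {k : ℕ} [NeZero k] {Δ : Type*}

/-- With both constraints switched off, `T` and `s` are dummy variables. -/
theorem factorSet_subset_iff (M M' : DFAO k Δ) :
    factorSet M.sequence ⊆ factorSet M'.sequence ↔
      ∀ i n, ∃ T : ℕ, ∀ s : ℕ, ∃ j, Match False False M M' i n T s j := by
  rw [Set.subset_def, forall_mem_factorSet]
  refine forall₂_congr fun i n => ?_
  simp only [Match, false_imp_iff, true_and, exists_const, forall_const, ← factorAt_eq_iff]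
  exact ⟨fun ⟨j, m, h⟩ => ⟨j, by
    have := congrArg List.length h
    simp only [length_factorAt] at this
    rwa [this] at h⟩, fun ⟨j, h⟩ => ⟨j, n, h⟩⟩

theorem isRecurrent_iff (M : DFAO k Δ) :
    IsRecurrent M.sequence ↔
      ∀ i n, ∃ T : ℕ, ∀ s : ℕ, ∃ j, Match True False M M i n T s j := by
  rw [IsRecurrent, forall_mem_factorSet]
  refine forall₂_congr fun i n => ?_
  simp only [infinite_iff_forall_exists_ge, mem_occurrences_factorAt, Match, true_imp_iff,
    false_imp_iff, true_and, exists_const, and_comm]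

theorem isUniformlyRecurrent_iff (M : DFAO k Δ) :
    IsUniformlyRecurrent M.sequence ↔
      ∀ i n, ∃ T : ℕ, ∀ s : ℕ, ∃ j, Match True True M M i n T s j := by
  rw [IsUniformlyRecurrent, forall_mem_factorSet]
  refine forall₂_congr fun i n => ?_
  rw [infinite_and_bounded_gaps_iff]
  simp only [mem_occurrences_factorAt, Match, true_imp_iff]
  exact exists_congr fun T => forall_congr' fun s => exists_congr fun j => by tauto

end DFAO

/-! ### Primitive recursive evaluation of automata. -/

namespace DFAO

variable {k : ℕ} {Δ : Type*}

theorem description_getElem? (M : DFAO k Δ) (q : Fin M.numStates) :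
    M.description.2[(q : ℕ)]? = some (M.output q, fun d => (M.step q d : ℕ)) := by
  simp [description]

variable [Primcodable Δ]

theorem primrec_description : Primrec (description : DFAO k Δ → _) := by
  let _ : Primcodable {c : ℕ × List (Δ × (Fin k → ℕ)) // Valid c} :=
    Primcodable.subtype primrecPred_valid
  have h : Primrec (equivDescription : DFAO k Δ ≃ _) := Primrec.of_equiv
  exact (Primrec.subtype_val (hp := primrecPred_valid)).comp h

theorem primrec_numStates : Primrec (numStates : DFAO k Δ → ℕ) :=
  (Primrec.list_length.comp (Primrec.snd.comp primrec_description)).of_eq fun M => by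
    simp [description]

variable [NeZero k]

theorem primrec_stateAt (hk : 2 ≤ k) :
    Primrec₂ fun (M : DFAO k Δ) (n : ℕ) => (M.stateAt n : ℕ) := by
  have hdigit : Primrec fun n : ℕ => Fin.ofNat k n :=
    Primrec.fin_val_iff.1 (Primrec.nat_mod.comp Primrec.id (Primrec.const k))
  have hlen : Primrec fun x : DFAO k Δ × List ℕ => x.2.length :=
    Primrec.list_length.comp Primrec.snd
  have hrow : Primrec₂ fun (x : DFAO k Δ × List ℕ) (q : ℕ) =>
      (x.1.description.2[q]?).map fun row => row.2 (Fin.ofNat k (x.2.length % k)) :=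
    Primrec.option_map
      (Primrec.list_getElem?.comp (Primrec.snd.comp (primrec_description.comp
        (Primrec.fst.comp Primrec.fst))) Primrec.snd)
      (Primrec.fin_app.comp (Primrec.snd.comp Primrec.snd)
        (hdigit.comp (Primrec.nat_mod.comp (hlen.comp (Primrec.fst.comp Primrec.fst))
          (Primrec.const k))))
  -- Course-of-values recursion: `l` lists the states at all smaller arguments, so `l.length` is the
  -- current argument.
  have hstep : Primrec₂ fun (M : DFAO k Δ) (l : List ℕ) =>
      if l.length = 0 then some M.description.1 else
        (l[l.length / k]?).bind fun q =>
          (M.description.2[q]?).map fun row => row.2 (Fin.ofNat k (l.length % k)) :=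
    Primrec.ite (Primrec.eq.comp hlen (Primrec.const 0))
      (Primrec.option_some.comp (Primrec.fst.comp (primrec_description.comp Primrec.fst)))
      (Primrec.option_bind
        (Primrec.list_getElem?.comp Primrec.snd (Primrec.nat_div.comp hlen (Primrec.const k))) hrow)
  refine Primrec.nat_strong_rec _ hstep fun M n => ?_
  rcases Nat.eq_zero_or_pos n with rfl | hn
  · simp [stateAt_zero, description]
  · have hlt : n / k < n := Nat.div_lt_self hn hk
    simp [hn.ne', hlt, description_getElem?, M.stateAt_of_pos hk hn]

theorem primrec_sequence (hk : 2 ≤ k) :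
    Primrec₂ fun (M : DFAO k Δ) (n : ℕ) => M.sequence n := by
  refine Primrec.option_some_iff.1 ?_
  refine (Primrec.option_map (Primrec.list_getElem?.comp (Primrec.snd.comp
    (primrec_description.comp Primrec.fst)) (primrec_stateAt hk))
    (Primrec.fst.comp Primrec.snd).to₂).of_eq fun x => ?_
  rw [description_getElem?]
  rfl

theorem primrec_pow : Primrec₂ ((· ^ ·) : ℕ → ℕ → ℕ) :=
  Primrec₂.unpaired'.1 Nat.Primrec.pow

theorem primrec_stateBound : Primrec₂ stateBound := by
  have two_pow : ∀ {f : ℕ × ℕ → ℕ}, Primrec f → Primrec fun x => 2 ^ f x := fun hf =>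
    primrec_pow.comp (Primrec.const 2) hf
  have sq : ∀ {f : ℕ × ℕ → ℕ}, Primrec f → Primrec fun x => 2 * f x ^ 2 := fun hf =>
    Primrec.nat_mul.comp (Primrec.const 2) (primrec_pow.comp hf (Primrec.const 2))
  have mul : ∀ {f : ℕ × ℕ → ℕ}, Primrec f → Primrec fun x => 8 * f x := fun hf =>
    Primrec.nat_mul.comp (Primrec.const 8) hf
  exact two_pow (two_pow (two_pow (two_pow (mul (mul (two_pow (mul
    (Primrec.nat_mul.comp (sq Primrec.fst) (sq Primrec.snd)))))))))

end DFAO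

/-! ### Decision by bounded search. -/

theorem PrimrecRel.forall_lt_comp {α : Type*} [Primcodable α] {R : α → ℕ → Prop}
    (hR : PrimrecRel R) {f : α → ℕ} (hf : Primrec f) : PrimrecPred fun a => ∀ x < f a, R a x :=
  (hR.swap.forall_mem_list.comp (Primrec.list_range.comp hf) Primrec.id).of_eq fun a => by
    simp [Function.swap]

theorem PrimrecRel.exists_lt_comp {α : Type*} [Primcodable α] {R : α → ℕ → Prop}
    (hR : PrimrecRel R) {f : α → ℕ} (hf : Primrec f) : PrimrecPred fun a => ∃ x < f a, R a x :=
  (hR.swap.exists_mem_list.comp (Primrec.list_range.comp hf) Primrec.id).of_eq fun a => by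
    simp [Function.swap]

/-- Since `p` does not depend on the input, a classical case split on it is harmless. -/
theorem PrimrecPred.const_imp {α : Type*} [Primcodable α] (p : Prop) {P : α → Prop}
    (hP : PrimrecPred P) : PrimrecPred fun a => p → P a := by
  by_cases hp : p
  · simpa [hp] using hP
  · exact (Primrec.eq.comp (Primrec.const 0) (Primrec.const 0) :
      PrimrecPred fun _ : α => (0 : ℕ) = 0).of_eq fun _ => by simp [hp]

namespace DFAO

variable {k : ℕ} [NeZero k] {Δ : Type*} [Primcodable Δ]

theorem primrecPred_match (hk : 2 ≤ k) (p q : Prop) {α : Type*} [Primcodable α]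
    {P : α → DFAO k Δ × DFAO k Δ} {i n T s j : α → ℕ} (hP : Primrec P) (hi : Primrec i)
    (hn : Primrec n) (hT : Primrec T) (hs : Primrec s) (hj : Primrec j) :
    PrimrecPred fun a => Match p q (P a).1 (P a).2 (i a) (n a) (T a) (s a) (j a) := by
  have heq : PrimrecRel fun (a : α) (t : ℕ) =>
      (P a).1.sequence (i a + t) = (P a).2.sequence (j a + t) :=
    Primrec.eq.comp
      ((primrec_sequence hk).comp (Primrec.fst.comp (hP.comp Primrec.fst))
        (Primrec.nat_add.comp (hi.comp Primrec.fst) Primrec.snd))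
      ((primrec_sequence hk).comp (Primrec.snd.comp (hP.comp Primrec.fst))
        (Primrec.nat_add.comp (hj.comp Primrec.fst) Primrec.snd))
  exact ((Primrec.nat_le.comp hs hj).const_imp p).and
    (((Primrec.nat_lt.comp hj (Primrec.nat_add.comp hs hT)).const_imp q).and
      (heq.forall_lt_comp hn))

theorem primrecPred_forall_exists_match (hk : 2 ≤ k) (p q : Prop) :
    PrimrecPred fun P : DFAO k Δ × DFAO k Δ =>
      ∀ i n, ∃ T, ∀ s, ∃ j, Match p q P.1 P.2 i n T s j := by
  have hc : Primrec fun P : DFAO k Δ × DFAO k Δ => stateBound P.1.numStates P.2.numStates :=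
    primrec_stateBound.comp (primrec_numStates.comp Primrec.fst)
      (primrec_numStates.comp Primrec.snd)
  have hb : ∀ m, Primrec fun P : DFAO k Δ × DFAO k Δ =>
      k ^ (m * stateBound P.1.numStates P.2.numStates) := fun m =>
    primrec_pow.comp (Primrec.const k) (Primrec.nat_mul.comp (Primrec.const m) hc)
  have f1 {α : Type _} [Primcodable α] : Primrec fun x : α × ℕ => x.1 := Primrec.fst
  have hm := primrecPred_match hk p q
    (α := (((((DFAO k Δ × DFAO k Δ) × ℕ) × ℕ) × ℕ) × ℕ) × ℕ)
    (f1.comp (f1.comp (f1.comp (f1.comp f1))))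
    (Primrec.snd.comp (f1.comp (f1.comp (f1.comp f1)))) (Primrec.snd.comp (f1.comp (f1.comp f1)))
    (Primrec.snd.comp (f1.comp f1)) (Primrec.snd.comp f1) Primrec.snd
  have hj := hm.primrecRel.exists_lt_comp ((hb 5).comp (f1.comp (f1.comp (f1.comp f1))))
  have hs := hj.primrecRel.forall_lt_comp ((hb 4).comp (f1.comp (f1.comp f1)))
  have hT := hs.primrecRel.exists_lt_comp ((hb 3).comp (f1.comp f1))
  have hn := hT.primrecRel.forall_lt_comp ((hb 2).comp f1)
  have hi := hn.primrecRel.forall_lt_comp (hb 1)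
  refine hi.of_eq fun P => ?_
  rw [match_bounded hk p q P.1 P.2 le_rfl, one_mul]

theorem primrecPred_isRecurrent (hk : 2 ≤ k) :
    PrimrecPred fun M : DFAO k Δ => IsRecurrent M.sequence :=
  ((primrecPred_forall_exists_match hk True False).comp (Primrec.id.pair Primrec.id)).of_eq
    fun M => M.isRecurrent_iff.symm

theorem primrecPred_isUniformlyRecurrent (hk : 2 ≤ k) :
    PrimrecPred fun M : DFAO k Δ => IsUniformlyRecurrent M.sequence :=
  ((primrecPred_forall_exists_match hk True True).comp (Primrec.id.pair Primrec.id)).of_eq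
    fun M => M.isUniformlyRecurrent_iff.symm

theorem primrecPred_factorSet_subset (hk : 2 ≤ k) :
    PrimrecPred fun P : DFAO k Δ × DFAO k Δ =>
      factorSet P.1.sequence ⊆ factorSet P.2.sequence :=
  (primrecPred_forall_exists_match hk False False).of_eq
    fun P => (factorSet_subset_iff P.1 P.2).symm

theorem primrecPred_factorSet_eq (hk : 2 ≤ k) :
    PrimrecPred fun P : DFAO k Δ × DFAO k Δ =>
      factorSet P.1.sequence = factorSet P.2.sequence :=
  ((primrecPred_factorSet_subset hk).and
    ((primrecPred_factorSet_subset hk).comp (Primrec.snd.pair Primrec.fst))).of_eq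
      fun _ => Set.Subset.antisymm_iff.symm

end DFAO

theorem mainTheorem6 (k : ℕ) [NeZero k] (hk : 2 ≤ k) (Δ : Type*) [Primcodable Δ] :
    ComputablePred (fun M : DFAO k Δ => IsRecurrent M.sequence) ∧
    ComputablePred (fun M : DFAO k Δ => IsUniformlyRecurrent M.sequence) ∧
    ComputablePred (fun P : DFAO k Δ × DFAO k Δ =>
      factorSet P.1.sequence = factorSet P.2.sequence) ∧
    ComputablePred (fun P : DFAO k Δ × DFAO k Δ =>
      factorSet P.1.sequence ⊆ factorSet P.2.sequence) := by
  exact ⟨(DFAO.primrecPred_isRecurrent hk).computablePred,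
    (DFAO.primrecPred_isUniformlyRecurrent hk).computablePred,
    (DFAO.primrecPred_factorSet_eq hk).computablePred,
    (DFAO.primrecPred_factorSet_subset hk).computablePred⟩
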